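/- Fix $\alpha\in(1/2,1)$ and let $m=\alpha/(1-\alpha)>1$. The $\alpha$-supercritical causal triangulation of the half-plane $\widetilde{\mathfrak T}$ is the random triangulation with vertex set $\mathbb N\times\mathbb Z$ ($\mathbb N=\{0,1,2,\dots\}$) defined as follows. For each $j\in\mathbb Z$, the layer between the horizontal lines $\mathbb N\times\{j\}$ and $\mathbb N\times\{j+1\}$ is cut into triangles, ordered from left to right, the leftmost one having the edge $(0,j)(0,j+1)$ as its left side; a triangle is called top-oriented if it has a horizontal edge on the upper line and bottom-oriented if it has one on the lower line. Independently for all triangles and all layers, each triangle is top-oriented with probability $\alpha$ and bottom-oriented with probability $1-\alpha$. Direct the non-horizontal edges from bottom to top and, given $\widetilde{\mathfrak T}$, declare each of them open with probability $p\in[0,1]$ and closed with probability $1-p$, independently of the others; horizontal edges play no role. Let $\widetilde{\mathcal C}$ be the set of vertices that can be reached from the origin $(0,0)$ by a directed path of open edges, and let $\widetilde\Theta(p)$ be the annealed probability (averaged over both the triangulation and the percolation) that $\widetilde{\mathcal C}$ is infinite. Put $$p_c=p_c(m)=\frac{\eta}{1+\eta},\qquad \eta=\frac1{m+1}\sum_{n\ge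 0}\frac{m-1}{m^{n+1}-1}.$$ Then the series defining $\eta$ converges, and for every $p\in[0,1]$ one has $\widetilde\Theta(p)=0$ if $p\le p_c$ and $\widetilde\Theta(p)>0$ if $p>p_c$. -/

import Mathlib

open MeasureTheory ProbabilityTheory

namespace SCTHP

/-- The vertex set `ℕ × ℤ` of a causal triangulation of the half-plane. The vertex `(i, j)` is the
`i`-th vertex from the left (starting with `i = 0`) at height `j`. -/
abbrev Vertex : Type := ℕ × ℤ

/-- The height of a vertex. -/
def height (v : Vertex) : ℤ := v.2

/-- The data of a causal triangulation of the half-plane: the layer between the heights `j` and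
`j + 1` is cut into triangles, numbered `k = 0, 1, 2, …` from left to right, and `θ j k` tells
whether the `k`-th triangle of that layer is top-oriented (`true`: it has an edge on the upper
boundary of the layer) or bottom-oriented (`false`: it has an edge on the lower boundary). -/
abbrev Triangulation : Type := ℤ → ℕ → Bool

/-- The number of top-oriented triangles among the `k` leftmost triangles of layer `j`. -/
def topCount (θ : Triangulation) (j : ℤ) (k : ℕ) : ℕ := Nat.count (fun i => θ j i = true) k

/-- The number of bottom-oriented triangles among the `k` leftmost triangles of layer `j`. -/
def bottomCount (θ : Triangulation) (j : ℤ) (k : ℕ) : ℕ := Nat.count (fun i => θ j i = false) k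

/-- The three corners of the `k`-th triangle of layer `j`. The left side of this triangle joins the
lower vertex number `bottomCount θ j k` to the upper vertex number `topCount θ j k`, since each
triangle further to the left has used one horizontal edge of the upper boundary (if it is
top-oriented) or of the lower boundary (if it is bottom-oriented). -/
def triangle (θ : Triangulation) (j : ℤ) (k : ℕ) : Set Vertex :=
  if θ j k = true then
    {(bottomCount θ j k, j), (topCount θ j k, j + 1), (topCount θ j k + 1, j + 1)}
  else
    {(bottomCount θ j k, j), (bottomCount θ j k + 1, j), (topCount θ j k, j + 1)}

/-- The non-horizontal edges of the triangulation, directed from bottom to top: the pairs `(v, w)`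
of corners of a common triangle such that `w` is one level above `v`. -/
def upEdges (θ : Triangulation) : Set (Vertex × Vertex) :=
  {e | height e.2 = height e.1 + 1 ∧ ∃ j k, e.1 ∈ triangle θ j k ∧ e.2 ∈ triangle θ j k}

/-- The law of the `α`-supercritical causal triangulation of the half-plane: the layers are
independent, and in each layer the triangles are independently top-oriented with probability `α` and
bottom-oriented with probability `1 - α`. -/
noncomputable def law (α : unitInterval) : Measure Triangulation :=
  Measure.infinitePi fun _ : ℤ => Measure.infinitePi fun _ : ℕ => bernoulliMeasure true false α

/-- The quenched law of directed Bernoulli bond percolation with parameter `p` on `θ`: the law of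
the random set of open edges, which contains each upward edge of `θ` independently with
probability `p`. -/
noncomputable def quenched (p : unitInterval) (θ : Triangulation) :
    Measure (Set (Vertex × Vertex)) :=
  setBernoulli (upEdges θ) p

/-- The directed percolation cluster of the origin `(0, 0)`: the vertices that can be reached from
it by a finite directed path of open edges. -/
def cluster (openEdges : Set (Vertex × Vertex)) : Set Vertex :=
  {v | Relation.ReflTransGen (fun u w => (u, w) ∈ openEdges) (0, 0) v}

/-- The annealed probability that the directed percolation cluster of the origin is infinite. -/
noncomputable def percolationProb (α p : unitInterval) : ENNReal :=
  ∫⁻ θ, quenched p θ {openEdges | (cluster openEdges).Infinite} ∂(law α)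

/-- The mean `m = α / (1 - α)` of the geometric law `k ↦ α ^ k * (1 - α)`. -/
noncomputable def mean (α : ℝ) : ℝ := α / (1 - α)

/-- The quantity `η = (m + 1)⁻¹ * ∑ n, (m - 1) / (m ^ (n + 1) - 1)`. -/
noncomputable def eta (m : ℝ) : ℝ := 1 / (m + 1) * ∑' n : ℕ, (m - 1) / (m ^ (n + 1) - 1)

/-- The critical point `p_c = η / (1 + η)`. -/
noncomputable def criticalPoint (m : ℝ) : ℝ := eta m / (1 + eta m)

end SCTHP

namespace SCTHP

open unitInterval
open scoped ENNReal

/-- Prepend a term to a sequence. -/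
def seqCons {X : Type*} (x : X) (s : ℕ → X) : ℕ → X
  | 0 => x
  | n + 1 => s n

@[simp] lemma seqCons_zero {X : Type*} (x : X) (s : ℕ → X) : seqCons x s 0 = x := rfl

@[simp] lemma seqCons_succ {X : Type*} (x : X) (s : ℕ → X) (n : ℕ) :
    seqCons x s (n + 1) = s n := rfl

lemma measurable_seqCons {X : Type*} [MeasurableSpace X] :
    Measurable fun q : X × (ℕ → X) => seqCons q.1 q.2 := by
  refine measurable_pi_iff.2 fun n => ?_
  cases n with
  | zero => exact measurable_fst
  | succ n => exact (measurable_pi_apply n).comp measurable_snd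

/-- The law of an i.i.d. sequence is invariant under prepending an independent term. -/
lemma map_seqCons_infinitePi {X : Type*} [MeasurableSpace X] (μ : Measure X)
    [IsProbabilityMeasure μ] :
    (μ.prod (Measure.infinitePi fun _ : ℕ => μ)).map (fun q => seqCons q.1 q.2) =
      Measure.infinitePi fun _ : ℕ => μ := by
  classical
  refine Measure.eq_infinitePi _ fun s t ht => ?_
  obtain ⟨N, hN⟩ := s.exists_nat_subset_range
  set t' : ℕ → Set X := fun i => if i ∈ s then t i else Set.univ with ht'
  have mt' : ∀ i, MeasurableSet (t' i) := fun i => by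
    simp only [ht']; split_ifs
    exacts [ht i, .univ]
  have hpre : (fun q : X × (ℕ → X) => seqCons q.1 q.2) ⁻¹' (Set.pi s t) =
      t' 0 ×ˢ Set.pi (Finset.range N : Set ℕ) (fun i => t' (i + 1)) := by
    ext ⟨x, f⟩
    simp only [Set.mem_preimage, Set.mem_pi, Set.mem_prod, Finset.mem_coe, ht']
    constructor
    · intro h
      refine ⟨?_, fun i _ => ?_⟩
      · split_ifs with h0
        exacts [h 0 h0, trivial]
      · split_ifs with h0
        exacts [h (i + 1) h0, trivial]
    · rintro ⟨h0, h1⟩ i hi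
      cases i with
      | zero => simpa [hi] using h0
      | succ i =>
        have := h1 i (by have := Finset.mem_range.1 (hN hi); simp; omega)
        simpa [hi] using this
  rw [Measure.map_apply measurable_seqCons (.pi s.countable_toSet fun _ _ => ht _), hpre,
    Measure.prod_prod, Measure.infinitePi_pi _ fun i _ => mt' (i + 1), mul_comm,
    ← Finset.prod_range_succ' fun i => μ (t' i)]
  have hs : s ⊆ Finset.range (N + 1) := hN.trans (Finset.range_subset_range.2 (Nat.le_succ N))
  rw [← Finset.prod_subset hs]
  · exact Finset.prod_congr rfl fun i hi => by simp [ht', hi]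
  · intro i _ hi
    simp [ht', hi]

lemma lintegral_infinitePi_nat {X : Type*} [MeasurableSpace X] (μ : Measure X)
    [IsProbabilityMeasure μ] {f : (ℕ → X) → ℝ≥0∞} (hf : Measurable f) :
    ∫⁻ s, f s ∂(Measure.infinitePi fun _ : ℕ => μ) =
      ∫⁻ x, ∫⁻ s, f (seqCons x s) ∂(Measure.infinitePi fun _ : ℕ => μ) ∂μ := by
  conv_lhs => rw [← map_seqCons_infinitePi μ]
  rw [lintegral_map hf measurable_seqCons,
    lintegral_prod (fun q : X × (ℕ → X) => f (seqCons q.1 q.2)) (hf.comp measurable_seqCons).aemeasurable]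

/-- The data of a layer: the orientations of its triangles and the states of its edges, both
numbered from left to right. -/
abbrev Layer : Type := (ℕ → Bool) × (ℕ → Prop)

/-- The lower endpoint of the `k`-th edge of a layer. -/
def lowerIndex (s : ℕ → Bool) (k : ℕ) : ℕ := Nat.count (fun i => s i = false) k

/-- The upper endpoint of the `k`-th edge of a layer. -/
def upperIndex (s : ℕ → Bool) (k : ℕ) : ℕ := Nat.count (fun i => s i = true) k

/-- The upper endpoints of the open edges of a layer whose lower endpoint is in `A`. -/
def next (A : Set ℕ) (z : Layer) : Set ℕ :=
  {x | ∃ k, z.2 k ∧ lowerIndex z.1 k ∈ A ∧ upperIndex z.1 k = x}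

/-- Translation of a set of natural numbers to the left, forgetting what becomes negative. -/
def shiftDown (A : Set ℕ) (c : ℕ) : Set ℕ := {x | x + c ∈ A}

/-- Translation of a set of natural numbers to the right by one. -/
def shiftUp (A : Set ℕ) : Set ℕ := {x | ∃ y ∈ A, x = y + 1}

/-- Prepend an edge, together with the triangle on its right, to a layer. -/
def layerCons (b : Bool) (o : Prop) (z : Layer) : Layer := (seqCons b z.1, seqCons o z.2)

@[simp] lemma lowerIndex_zero (s : ℕ → Bool) : lowerIndex s 0 = 0 := Nat.count_zero _

@[simp] lemma upperIndex_zero (s : ℕ → Bool) : upperIndex s 0 = 0 := Nat.count_zero _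

@[simp] lemma lowerIndex_seqCons_succ (b : Bool) (s : ℕ → Bool) (k : ℕ) :
    lowerIndex (seqCons b s) (k + 1) = lowerIndex s k + if b = false then 1 else 0 :=
  Nat.count_succ' _ _

@[simp] lemma upperIndex_seqCons_succ (b : Bool) (s : ℕ → Bool) (k : ℕ) :
    upperIndex (seqCons b s) (k + 1) = upperIndex s k + if b = true then 1 else 0 :=
  Nat.count_succ' _ _

lemma mem_next_layerCons_true {A : Set ℕ} {o : Prop} {z : Layer} {x : ℕ} :
    x ∈ next A (layerCons true o z) ↔ (x = 0 ∧ o ∧ 0 ∈ A) ∨ ∃ y ∈ next A z, x = y + 1 := by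
  constructor
  · rintro ⟨k, h1, h2, h3⟩
    cases k with
    | zero => exact Or.inl ⟨by simpa using h3.symm, h1, by simpa using h2⟩
    | succ k =>
      refine Or.inr ⟨_, ⟨k, h1, ?_, rfl⟩, ?_⟩
      · simpa [layerCons] using h2
      · simpa [layerCons] using h3.symm
  · rintro (⟨rfl, ho, h0⟩ | ⟨y, ⟨k, h1, h2, h3⟩, rfl⟩)
    · exact ⟨0, ho, by simpa using h0, by simp⟩
    · refine ⟨k + 1, h1, ?_, ?_⟩
      · simpa [layerCons] using h2
      · simpa [layerCons] using h3

lemma mem_next_layerCons_false {A : Set ℕ} {o : Prop} {z : Layer} {x : ℕ} :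
    x ∈ next A (layerCons false o z) ↔ (x = 0 ∧ o ∧ 0 ∈ A) ∨ x ∈ next (shiftDown A 1) z := by
  constructor
  · rintro ⟨k, h1, h2, h3⟩
    cases k with
    | zero => exact Or.inl ⟨by simpa using h3.symm, h1, by simpa using h2⟩
    | succ k =>
      refine Or.inr ⟨k, h1, ?_, ?_⟩
      · simpa [layerCons, shiftDown] using h2
      · simpa [layerCons] using h3
  · rintro (⟨rfl, ho, h0⟩ | ⟨k, h1, h2, h3⟩)
    · exact ⟨0, ho, by simpa using h0, by simp⟩
    · refine ⟨k + 1, h1, ?_, ?_⟩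
      · simpa [layerCons, shiftDown] using h2
      · simpa [layerCons] using h3

lemma shiftDown_zero (A : Set ℕ) : shiftDown A 0 = A := rfl

lemma shiftDown_shiftDown (A : Set ℕ) (c d : ℕ) :
    shiftDown (shiftDown A c) d = shiftDown A (d + c) := by
  ext x; simp [shiftDown, add_assoc]

lemma shiftDown_next_layerCons_true (A : Set ℕ) (o : Prop) (z : Layer) (c : ℕ) :
    shiftDown (next A (layerCons true o z)) (c + 1) = shiftDown (next A z) c := by
  ext x
  simp only [shiftDown, Set.mem_ofPred_eq, mem_next_layerCons_true]
  constructor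
  · rintro (⟨h, -⟩ | ⟨y, hy, h⟩)
    · omega
    · obtain rfl : x + c = y := by omega
      exact hy
  · exact fun h => Or.inr ⟨_, h, by omega⟩

lemma shiftDown_next_layerCons_false (A : Set ℕ) (o : Prop) (z : Layer) (c : ℕ) :
    shiftDown (next A (layerCons false o z)) (c + 1) =
      shiftDown (next (shiftDown A 1) z) (c + 1) := by
  ext x
  simp only [shiftDown, Set.mem_ofPred_eq, mem_next_layerCons_false]
  constructor
  · rintro (⟨h, -⟩ | h)
    · omega
    · exact h
  · exact Or.inr

lemma next_layerCons_true_of_closed (A : Set ℕ) {o : Prop} (z : Layer) (h : ¬(o ∧ 0 ∈ A)) :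
    next A (layerCons true o z) = shiftUp (next A z) := by
  ext x
  simp [mem_next_layerCons_true, shiftUp, h]

lemma next_layerCons_false_of_closed (A : Set ℕ) {o : Prop} (z : Layer) (h : ¬(o ∧ 0 ∈ A)) :
    next A (layerCons false o z) = next (shiftDown A 1) z := by
  ext x
  simp [mem_next_layerCons_false, h]

lemma next_layerCons_of_open {A : Set ℕ} {o : Prop} (b : Bool) (z : Layer) (ho : o) (h : 0 ∈ A) :
    next A (layerCons b o z) = insert 0 (next A (layerCons b False z)) := by
  ext x
  cases b <;> simp [mem_next_layerCons_false, mem_next_layerCons_true, ho, h]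

lemma insert_next_layerCons {A : Set ℕ} {o : Prop} (b : Bool) (z : Layer) :
    insert 0 (next A (layerCons b o z)) = insert 0 (next A (layerCons b False z)) := by
  ext x
  cases b <;> simp [mem_next_layerCons_false, mem_next_layerCons_true] <;> tauto

lemma shiftDown_shiftUp (A : Set ℕ) : shiftDown (shiftUp A) 1 = A := by
  ext x
  simp [shiftDown, shiftUp]

lemma zero_notMem_shiftUp (A : Set ℕ) : 0 ∉ shiftUp A := by
  simp [shiftUp]

lemma shiftUp_nonempty {A : Set ℕ} : (shiftUp A).Nonempty ↔ A.Nonempty :=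
  ⟨fun ⟨_, y, hy, _⟩ => ⟨y, hy⟩, fun ⟨y, hy⟩ => ⟨y + 1, y, hy, rfl⟩⟩

lemma next_empty (z : Layer) : next ∅ z = ∅ := by
  ext x; simp [next]

lemma measurable_layerCons (b : Bool) (o : Prop) : Measurable (layerCons b o) :=
  (measurable_seqCons.comp (measurable_const.prodMk measurable_fst)).prodMk
    (measurable_seqCons.comp (measurable_const.prodMk measurable_snd))

lemma measurable_count_eq (b : Bool) (k : ℕ) :
    Measurable fun s : ℕ → Bool => Nat.count (fun i => s i = b) k := by
  induction k with
  | zero => simp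
  | succ k ih =>
    simp only [Nat.count_succ]
    exact ih.add (Measurable.ite (measurableSet_setOfPred.2
      ((measurable_of_countable (fun c : Bool => c = b)).comp (measurable_pi_apply k)))
      measurable_const measurable_const)

lemma measurable_lowerIndex (k : ℕ) : Measurable fun s => lowerIndex s k :=
  measurable_count_eq false k

lemma measurable_upperIndex (k : ℕ) : Measurable fun s => upperIndex s k :=
  measurable_count_eq true k

lemma measurable_next : Measurable fun q : Set ℕ × Layer => next q.1 q.2 := by
  refine measurable_set_iff.2 fun x => ?_
  simp only [next, Set.mem_ofPred_eq]
  refine Measurable.exists fun k => ?_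
  have hθ : Measurable fun q : Set ℕ × Layer => q.2.1 := measurable_fst.comp measurable_snd
  refine Measurable.and ((measurable_pi_apply k).comp (measurable_snd.comp measurable_snd)) ?_
  refine Measurable.and ?_ ((measurable_of_countable (fun n : ℕ => n = x)).comp
    ((measurable_upperIndex k).comp hθ))
  have : (fun q : Set ℕ × Layer => lowerIndex q.2.1 k ∈ q.1) =
      fun q => ∃ n, lowerIndex q.2.1 k = n ∧ n ∈ q.1 := by
    ext q; simp
  rw [this]
  exact Measurable.exists fun n =>
    ((measurable_of_countable (fun i : ℕ => i = n)).comp ((measurable_lowerIndex k).comp hθ)).and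
      ((measurable_set_mem n).comp measurable_fst)

lemma measurable_shiftDown (c : ℕ) : Measurable fun A => shiftDown A c :=
  measurable_set_iff.2 fun x => measurable_set_mem (x + c)

lemma measurable_insert_zero : Measurable fun A : Set ℕ => insert 0 A := by
  refine measurable_set_iff.2 fun x => ?_
  simp only [Set.mem_insert_iff]
  exact measurable_const.or (measurable_set_mem x)

lemma measurableSet_nonempty : MeasurableSet {A : Set ℕ | A.Nonempty} := by
  exact measurableSet_setOfPred.2 <| Measurable.exists fun y => measurable_set_mem y

/-- The law of the orientations of the triangles of a layer. -/
noncomputable def triangleLaw (α : I) : Measure (ℕ → Bool) :=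
  Measure.infinitePi fun _ : ℕ => bernoulliMeasure true false α

/-- The law of the states of the edges of a layer. -/
noncomputable def edgeLaw (p : I) : Measure (ℕ → Prop) :=
  Measure.infinitePi fun _ : ℕ => bernoulliMeasure True False p

instance (α : I) : IsProbabilityMeasure (triangleLaw α) := by
  unfold triangleLaw; infer_instance

instance (p : I) : IsProbabilityMeasure (edgeLaw p) := by
  unfold edgeLaw; infer_instance

/-- The law of a layer. -/
noncomputable def layerLaw (α p : I) : Measure Layer := (triangleLaw α).prod (edgeLaw p)

instance (α p : I) : IsProbabilityMeasure (layerLaw α p) := by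
  unfold layerLaw; infer_instance

lemma lintegral_bernoulliMeasure {X : Type*} [MeasurableSpace X] [MeasurableSingletonClass X]
    (x y : X) (p : I) (f : X → ℝ≥0∞) :
    ∫⁻ z, f z ∂(bernoulliMeasure x y p) = toNNReal p * f x + toNNReal (σ p) * f y := by
  rw [bernoulliMeasure_def, lintegral_add_measure, lintegral_smul_measure, lintegral_smul_measure,
    lintegral_dirac, lintegral_dirac]
  rfl

/-- Decomposition of the law of a layer according to its leftmost edge and triangle. -/
lemma lintegral_layerLaw (α p : I) {g : Layer → ℝ≥0∞} (hg : Measurable g) :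
    ∫⁻ z, g z ∂(layerLaw α p) =
      toNNReal p * (toNNReal α * ∫⁻ z, g (layerCons true True z) ∂(layerLaw α p) +
        toNNReal (σ α) * ∫⁻ z, g (layerCons false True z) ∂(layerLaw α p)) +
      toNNReal (σ p) * (toNNReal α * ∫⁻ z, g (layerCons true False z) ∂(layerLaw α p) +
        toNNReal (σ α) * ∫⁻ z, g (layerCons false False z) ∂(layerLaw α p)) := by
  have key : ∀ b o, ∫⁻ z, g (layerCons b o z) ∂(layerLaw α p) =
      ∫⁻ θ, ∫⁻ ω, g (seqCons b θ, seqCons o ω) ∂(edgeLaw p) ∂(triangleLaw α) := fun b o =>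
    lintegral_prod _ (hg.comp (measurable_layerCons b o)).aemeasurable
  have m1 : Measurable fun θ => ∫⁻ ω, g (θ, ω) ∂(edgeLaw p) := hg.lintegral_prod_right'
  have m2 : ∀ b o, Measurable fun θ => ∫⁻ ω, g (seqCons b θ, seqCons o ω) ∂(edgeLaw p) :=
    fun b o => (hg.comp (measurable_layerCons b o)).lintegral_prod_right'
  have e1 : ∀ θ, ∫⁻ ω, g (θ, ω) ∂(edgeLaw p) =
      toNNReal p * ∫⁻ ω, g (θ, seqCons True ω) ∂(edgeLaw p) +
        toNNReal (σ p) * ∫⁻ ω, g (θ, seqCons False ω) ∂(edgeLaw p) := fun θ => by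
    rw [edgeLaw, lintegral_infinitePi_nat (f := fun ω => g (θ, ω)) _
      (hg.comp measurable_prodMk_left),
      lintegral_bernoulliMeasure]
  simp only [key]
  rw [layerLaw, lintegral_prod _ hg.aemeasurable, triangleLaw,
    lintegral_infinitePi_nat _ m1, lintegral_bernoulliMeasure, ← triangleLaw]
  simp only [e1]
  rw [lintegral_add_left ((m2 _ _).const_mul _), lintegral_add_left ((m2 _ _).const_mul _),
    lintegral_const_mul _ (m2 _ _), lintegral_const_mul _ (m2 _ _), lintegral_const_mul _ (m2 _ _),
    lintegral_const_mul _ (m2 _ _)]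
  ring

section Survival

lemma coe_toNNReal_add_symm (p : I) :
    ((toNNReal p : ℝ≥0∞)) + (toNNReal (σ p) : ℝ≥0∞) = 1 := by
  rw [← ENNReal.coe_add, ← ENNReal.coe_one, ENNReal.coe_inj]
  ext
  simp

/-- The probability that the cluster of `A × {0}` reaches height `n`. -/
noncomputable def survival (α p : I) : ℕ → Set ℕ → ℝ≥0∞
  | 0, A => Set.indicator {B : Set ℕ | B.Nonempty} 1 A
  | n + 1, A => ∫⁻ z, survival α p n (next A z) ∂(layerLaw α p)

variable (α p : I)

lemma measurable_survival (n : ℕ) : Measurable (survival α p n) := by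
  induction n with
  | zero => exact measurable_one.indicator measurableSet_nonempty
  | succ n ih => exact (ih.comp measurable_next).lintegral_prod_right'

lemma measurable_survival_next (n : ℕ) (A : Set ℕ) :
    Measurable fun z => survival α p n (next A z) :=
  (measurable_survival α p n).comp (measurable_next.comp measurable_prodMk_left)

lemma measurable_survival_shiftDown (n c : ℕ) :
    Measurable fun A => survival α p n (shiftDown A c) :=
  (measurable_survival α p n).comp (measurable_shiftDown c)

lemma survival_le_one (n : ℕ) (A : Set ℕ) : survival α p n A ≤ 1 := by
  induction n generalizing A with
  | zero => exact Set.indicator_le_self' (fun _ _ => zero_le_one) A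
  | succ n ih =>
    refine (lintegral_mono fun z => ih (next A z)).trans ?_
    simp

lemma survival_empty (n : ℕ) : survival α p n ∅ = 0 := by
  induction n with
  | zero => simp [survival]
  | succ n ih => simp [survival, next_empty, ih]

lemma lintegral_layerLaw_of_irrel {g : Layer → ℝ≥0∞} {f : Bool → Layer → ℝ≥0∞}
    (hg : Measurable g) (h : ∀ b o z, g (layerCons b o z) = f b z) :
    ∫⁻ z, g z ∂(layerLaw α p) = toNNReal α * ∫⁻ z, f true z ∂(layerLaw α p) +
      toNNReal (σ α) * ∫⁻ z, f false z ∂(layerLaw α p) := by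
  rw [lintegral_layerLaw α p hg]
  simp only [h]
  rw [← add_mul, coe_toNNReal_add_symm, one_mul]

lemma survival_shiftUp {α : I} (hα : (α : ℝ) < 1) (n : ℕ) (A : Set ℕ) :
    survival α p n (shiftUp A) = survival α p n A := by
  induction n generalizing A with
  | zero =>
    classical
    simp only [survival, Set.indicator_apply, Set.mem_ofPred_eq, shiftUp_nonempty, Pi.one_apply]
  | succ n ih =>
    have h0 : ∀ o : Prop, ¬(o ∧ 0 ∈ shiftUp A) := fun o h => zero_notMem_shiftUp A h.2
    have key : survival α p (n + 1) (shiftUp A) =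
        toNNReal α * survival α p (n + 1) (shiftUp A) +
          toNNReal (σ α) * survival α p (n + 1) A := by
      refine lintegral_layerLaw_of_irrel α p (measurable_survival_next α p n (shiftUp A))
        (f := fun b z => if b then survival α p n (next (shiftUp A) z)
          else survival α p n (next A z)) fun b o z => ?_
      cases b
      · rw [next_layerCons_false_of_closed _ z (h0 o), shiftDown_shiftUp]; rfl
      · rw [next_layerCons_true_of_closed _ z (h0 o), ih]; rfl
    have h1 := survival_le_one α p (n + 1) (shiftUp A)
    have key' : toNNReal α * survival α p (n + 1) (shiftUp A) +
        toNNReal (σ α) * survival α p (n + 1) (shiftUp A) =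
        toNNReal α * survival α p (n + 1) (shiftUp A) +
          toNNReal (σ α) * survival α p (n + 1) A := by
      rw [← key, ← add_mul, coe_toNNReal_add_symm, one_mul]
    have hfin : (toNNReal α : ℝ≥0∞) * survival α p (n + 1) (shiftUp A) ≠ ∞ :=
      ENNReal.mul_ne_top ENNReal.coe_ne_top (h1.trans_lt ENNReal.one_lt_top).ne
    have h2 := (ENNReal.add_right_inj hfin).1 key'
    refine (ENNReal.mul_right_inj ?_ ENNReal.coe_ne_top).1 h2
    rw [Ne, ENNReal.coe_eq_zero]
    intro h
    have := congrArg NNReal.toReal h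
    simp at this
    linarith

/-- The law of the set of vertices at height `j` that can be reached from one of the vertices
`(0, 0), …, (0, j)`. -/
noncomputable def reachLaw : ℕ → Measure (Set ℕ)
  | 0 => Measure.dirac {0}
  | j + 1 => ((reachLaw j).prod (layerLaw α p)).map fun q => insert 0 (next q.1 q.2)

lemma measurable_insert_next : Measurable fun q : Set ℕ × Layer => insert 0 (next q.1 q.2) :=
  measurable_insert_zero.comp measurable_next

instance (j : ℕ) : IsProbabilityMeasure (reachLaw α p j) := by
  induction j with
  | zero => rw [reachLaw]; infer_instance
  | succ j ih => exact Measure.isProbabilityMeasure_map measurable_insert_next.aemeasurable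

lemma zero_mem_reachLaw (j : ℕ) : ∀ᵐ A ∂(reachLaw α p j), 0 ∈ A := by
  have hm : MeasurableSet {A : Set ℕ | 0 ∈ A} := measurableSet_setOfPred.2 (measurable_set_mem 0)
  cases j with
  | zero => rw [reachLaw, ae_dirac_iff hm]; rfl
  | succ j =>
    rw [reachLaw, ae_map_iff measurable_insert_next.aemeasurable hm]
    exact .of_forall fun q => Set.mem_insert _ _

lemma lintegral_reachLaw_succ (j : ℕ) {f : Set ℕ → ℝ≥0∞} (hf : Measurable f) :
    ∫⁻ A, f A ∂(reachLaw α p (j + 1)) =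
      ∫⁻ A, ∫⁻ z, f (insert 0 (next A z)) ∂(layerLaw α p) ∂(reachLaw α p j) := by
  rw [reachLaw, lintegral_map hf measurable_insert_next,
    lintegral_prod (fun q : Set ℕ × Layer => f (insert 0 (next q.1 q.2)))
      (hf.comp measurable_insert_next).aemeasurable]

/-- The probability that height `j + n` can be reached from one of the vertices at height `j` whose
number is at least `c` and that are connected to one of `(0, 0), …, (0, j)`. -/
noncomputable def boundarySurvival (j n c : ℕ) : ℝ≥0∞ :=
  ∫⁻ A, survival α p n (shiftDown A c) ∂(reachLaw α p j)

/-- The probability that height `j + 1 + n` can be reached from one of the vertices at height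
`j + 1` whose number is at least `c`, by way of a vertex at height `j` that is connected to one of
`(0, 0), …, (0, j)` and whose number is at least `d`; the layer above height `j` starts at
`d`. -/
noncomputable def boundarySurvivalAux (j n c d : ℕ) : ℝ≥0∞ :=
  ∫⁻ A, ∫⁻ z, survival α p n (shiftDown (next (shiftDown A d) z) c) ∂(layerLaw α p)
    ∂(reachLaw α p j)

lemma boundarySurvival_le_one (j n c : ℕ) : boundarySurvival α p j n c ≤ 1 := by
  refine (lintegral_mono fun A => survival_le_one α p n _).trans ?_
  simp

lemma boundarySurvivalAux_le_one (j n c d : ℕ) : boundarySurvivalAux α p j n c d ≤ 1 := by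
  refine (lintegral_mono fun A => lintegral_mono fun z => survival_le_one α p n _).trans ?_
  simp

lemma boundarySurvivalAux_zero (j n d : ℕ) :
    boundarySurvivalAux α p j n 0 d = boundarySurvival α p j (n + 1) d := rfl

lemma measurable_survival_shiftDown_next (n c d : ℕ) : Measurable fun q : Set ℕ × Layer =>
    survival α p n (shiftDown (next (shiftDown q.1 d) q.2) c) :=
  (measurable_survival α p n).comp <| (measurable_shiftDown c).comp <|
    measurable_next.comp <| ((measurable_shiftDown d).comp measurable_fst).prodMk measurable_snd

lemma boundarySurvivalAux_succ (j n c d : ℕ) :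
    boundarySurvivalAux α p j n (c + 1) d = toNNReal α * boundarySurvivalAux α p j n c d +
      toNNReal (σ α) * boundarySurvivalAux α p j n (c + 1) (d + 1) := by
  have m : ∀ c d, Measurable fun A : Set ℕ =>
      ∫⁻ z, survival α p n (shiftDown (next (shiftDown A d) z) c) ∂(layerLaw α p) := fun c d =>
    (measurable_survival_shiftDown_next α p n c d).lintegral_prod_right'
  unfold boundarySurvivalAux
  rw [← lintegral_const_mul _ (m _ _), ← lintegral_const_mul _ (m _ _),
    ← lintegral_add_left ((m _ _).const_mul _)]
  refine lintegral_congr fun A => ?_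
  refine lintegral_layerLaw_of_irrel α p
    ((measurable_survival_shiftDown_next α p n (c + 1) d).comp measurable_prodMk_left)
    (f := fun b z => if b then survival α p n (shiftDown (next (shiftDown A d) z) c)
      else survival α p n (shiftDown (next (shiftDown A (d + 1)) z) (c + 1))) fun b o z => ?_
  cases b
  · simp only [shiftDown_next_layerCons_false, shiftDown_shiftDown, add_comm 1 d]
    rfl
  · simp only [shiftDown_next_layerCons_true]
    rfl

lemma boundarySurvival_succ_succ (j n c : ℕ) :
    boundarySurvival α p (j + 1) n (c + 1) = boundarySurvivalAux α p j n (c + 1) 0 := by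
  unfold boundarySurvival
  rw [lintegral_reachLaw_succ α p j (measurable_survival_shiftDown α p n _)]
  refine lintegral_congr fun A => lintegral_congr fun z => ?_
  congr 1
  ext x
  simp [shiftDown]

lemma boundarySurvival_zero_succ (n c : ℕ) : boundarySurvival α p 0 n (c + 1) = 0 := by
  unfold boundarySurvival
  rw [reachLaw, lintegral_dirac' _ (measurable_survival_shiftDown α p n _),
    ← survival_empty α p n]
  congr 1
  ext x
  simp [shiftDown]

lemma boundarySurvival_zero_zero (n : ℕ) :
    boundarySurvival α p 0 n 0 = survival α p n {0} := by
  unfold boundarySurvival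
  rw [reachLaw, lintegral_dirac' _ (measurable_survival_shiftDown α p n _)]
  rfl

lemma boundarySurvival_zero_right (j : ℕ) : boundarySurvival α p j 0 0 = 1 := by
  have h : ∀ᵐ A ∂(reachLaw α p j), survival α p 0 (shiftDown A 0) = 1 := by
    filter_upwards [zero_mem_reachLaw α p j] with A hA
    exact Set.indicator_of_mem (⟨0, hA⟩ : A.Nonempty) _
  rw [boundarySurvival, lintegral_congr_ae h]
  simp

/-- Decomposition according to the first edge and the first triangle of the layer above
height `j`. -/
lemma boundarySurvival_step {α : I} (hα : (α : ℝ) < 1) (j n : ℕ) :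
    boundarySurvival α p j (n + 1) 0 = toNNReal p * boundarySurvival α p (j + 1) n 0 +
      toNNReal (σ p) * (toNNReal α * boundarySurvival α p j (n + 1) 0 +
        toNNReal (σ α) * boundarySurvival α p j (n + 1) 1) := by
  have m0 := measurable_survival α p n
  have m := measurable_survival_shiftDown α p (n + 1)
  have mi : Measurable fun A : Set ℕ =>
      ∫⁻ z, survival α p n (insert 0 (next A z)) ∂(layerLaw α p) :=
    (m0.comp measurable_insert_next).lintegral_prod_right'
  have e : boundarySurvival α p (j + 1) n 0 =
      ∫⁻ A, ∫⁻ z, survival α p n (insert 0 (next A z)) ∂(layerLaw α p) ∂(reachLaw α p j) :=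
    lintegral_reachLaw_succ α p j (m0.comp (measurable_shiftDown 0))
  rw [e]
  unfold boundarySurvival
  rw [← lintegral_const_mul _ mi, ← lintegral_const_mul _ (m 0), ← lintegral_const_mul _ (m 1),
    ← lintegral_add_left ((m 0).const_mul _),
    ← lintegral_const_mul (toNNReal (σ p) : ℝ≥0∞)
      (f := fun A => toNNReal α * survival α p (n + 1) (shiftDown A 0) +
        toNNReal (σ α) * survival α p (n + 1) (shiftDown A 1))
      (((m 0).const_mul _).add ((m 1).const_mul _)),
    ← lintegral_add_left (mi.const_mul _)]
  refine lintegral_congr_ae ?_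
  filter_upwards [zero_mem_reachLaw α p j] with A hA
  have e1 : ∫⁻ z, survival α p n (insert 0 (next A z)) ∂(layerLaw α p) =
      toNNReal α * ∫⁻ z, survival α p n (next A (layerCons true True z)) ∂(layerLaw α p) +
      toNNReal (σ α) * ∫⁻ z, survival α p n (next A (layerCons false True z)) ∂(layerLaw α p) := by
    refine lintegral_layerLaw_of_irrel α p
      (m0.comp (measurable_insert_next.comp measurable_prodMk_left))
      (f := fun b z => survival α p n (next A (layerCons b True z))) fun b o z => ?_
    rw [insert_next_layerCons, next_layerCons_of_open b z trivial hA]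
  have e2 : ∀ z, survival α p n (next A (layerCons true False z)) = survival α p n (next A z) :=
    fun z => by
      rw [next_layerCons_true_of_closed A z (fun h => h.1), survival_shiftUp p hα]
  have e3 : ∀ z, survival α p n (next A (layerCons false False z)) =
      survival α p n (next (shiftDown A 1) z) :=
    fun z => by rw [next_layerCons_false_of_closed A z (fun h => h.1)]
  rw [e1, shiftDown_zero]
  change ∫⁻ z, survival α p n (next A z) ∂(layerLaw α p) = _
  rw [lintegral_layerLaw α p (measurable_survival_next α p n A)]
  simp only [e2, e3]
  rfl

end Survival

/-- The sequence with first term `1` that solves the renewal equation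
`w (j + 1) = ρ * ∑ i ≤ j, a i * w (j - i)`. -/
noncomputable def renewal (ρ : ℝ) (a : ℕ → ℝ) : ℕ → ℝ
  | 0 => 1
  | j + 1 => ρ * ∑ i : Fin (j + 1), a i * renewal ρ a (j - i)
decreasing_by omega

lemma renewal_zero (ρ : ℝ) (a : ℕ → ℝ) : renewal ρ a 0 = 1 := by rw [renewal]

lemma renewal_succ (ρ : ℝ) (a : ℕ → ℝ) (j : ℕ) :
    renewal ρ a (j + 1) = ρ * ∑ i ∈ Finset.range (j + 1), a i * renewal ρ a (j - i) := by
  rw [renewal, ← Fin.sum_univ_eq_sum_range fun i => a i * renewal ρ a (j - i)]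

section Renewal

variable {ρ : ℝ} {a : ℕ → ℝ}

lemma renewal_nonneg (hρ : 0 ≤ ρ) (ha : ∀ i, 0 ≤ a i) (j : ℕ) : 0 ≤ renewal ρ a j := by
  induction j using Nat.strong_induction_on with
  | _ j ih =>
    cases j with
    | zero => simp [renewal_zero]
    | succ j =>
      rw [renewal_succ]
      exact mul_nonneg hρ (Finset.sum_nonneg fun i _ => mul_nonneg (ha i) (ih _ (by omega)))

lemma sum_renewal_le (hρ : 0 ≤ ρ) (ha : ∀ i, 0 ≤ a i) (hs : Summable a)
    (h : ρ * ∑' i, a i < 1) (N : ℕ) :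
    ∑ j ∈ Finset.range N, renewal ρ a j ≤ 1 / (1 - ρ * ∑' i, a i) := by
  set A := ∑' i, a i
  have hA : 0 < 1 - ρ * A := by linarith
  have h0 : 0 ≤ 1 / (1 - ρ * A) := by positivity
  induction N using Nat.strong_induction_on with
  | _ N ih =>
    cases N with
    | zero => simpa using h0
    | succ N =>
      rw [Finset.sum_range_succ']
      simp only [renewal_succ, renewal_zero]
      rw [← Finset.mul_sum, Finset.sum_range_diag_flip N fun i k => a i * renewal ρ a k]
      have h1 : ∑ i ∈ Finset.range N, ∑ k ∈ Finset.range (N - i), a i * renewal ρ a k ≤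
          A * (1 / (1 - ρ * A)) := by
        calc _ ≤ ∑ i ∈ Finset.range N, a i * (1 / (1 - ρ * A)) := by
              refine Finset.sum_le_sum fun i _ => ?_
              rw [← Finset.mul_sum]
              exact mul_le_mul_of_nonneg_left (ih _ (by omega)) (ha i)
          _ ≤ A * (1 / (1 - ρ * A)) := by
              rw [← Finset.sum_mul]
              exact mul_le_mul_of_nonneg_right (hs.sum_le_tsum _ fun i _ => ha i) h0
      have h2 := mul_le_mul_of_nonneg_left h1 hρ
      have h3 : ρ * (A * (1 / (1 - ρ * A))) + 1 = 1 / (1 - ρ * A) := by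
        field_simp
        ring
      linarith

lemma exists_lt_sum_renewal (hρ : 0 ≤ ρ) (ha : ∀ i, 0 ≤ a i) (hs : Summable a)
    (h : 1 ≤ ρ * ∑' i, a i) (C : ℝ) :
    ∃ N, C < ∑ j ∈ Finset.range N, renewal ρ a j := by
  by_contra! hC
  have hw := renewal_nonneg hρ ha
  have hsw : Summable (renewal ρ a) := summable_of_sum_range_le hw hC
  have h1 := tsum_mul_tsum_eq_tsum_sum_range_of_summable_norm hs.norm hsw.norm
  have h2 := hsw.sum_add_tsum_nat_add 1
  simp only [renewal_succ, tsum_mul_left, ← h1, Finset.sum_range_one, renewal_zero] at h2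
  have h3 : 0 ≤ ∑' j, renewal ρ a j := tsum_nonneg hw
  nlinarith

end Renewal

/-- The probability that a Galton--Watson tree with offspring law `k ↦ (1 - a) ^ k * a` is extinct
at generation `i`. -/
noncomputable def extinct (a : ℝ) : ℕ → ℝ
  | 0 => 0
  | i + 1 => a / (1 - (1 - a) * extinct a i)

section Extinct

variable {a : ℝ}

lemma extinct_mem (h0 : 0 < a) (h1 : a < 1) (i : ℕ) : 0 ≤ extinct a i ∧ extinct a i ≤ 1 := by
  induction i with
  | zero => simp [extinct]
  | succ i ih =>
    have : a ≤ 1 - (1 - a) * extinct a i := by nlinarith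
    rw [extinct]
    exact ⟨div_nonneg h0.le (h0.le.trans this), (div_le_one (h0.trans_le this)).2 this⟩

lemma extinct_succ_eq (h0 : 0 < a) (h1 : a < 1) (i : ℕ) :
    extinct a (i + 1) = a + (1 - a) * extinct a i * extinct a (i + 1) := by
  have := extinct_mem h0 h1 i
  have : 0 < 1 - (1 - a) * extinct a i := by nlinarith
  rw [extinct]
  field_simp
  ring

lemma one_lt_mean (h : 1 / 2 < a) (h1 : a < 1) : 1 < mean a := by
  rw [mean, lt_div_iff₀ (by linarith)]
  linarith

lemma one_sub_extinct (h : 1 / 2 < a) (h1 : a < 1) (i : ℕ) :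
    1 - extinct a i = (mean a - 1) / (mean a ^ (i + 1) - 1) := by
  have hm := one_lt_mean h h1
  induction i with
  | zero =>
    rw [extinct, pow_one, div_self (by linarith), sub_zero]
  | succ i ih =>
    have hq : 1 < mean a ^ (i + 1) := one_lt_pow₀ hm (by omega)
    have hq' : 1 < mean a ^ (i + 1 + 1) := one_lt_pow₀ hm (by omega)
    have hx : extinct a i = 1 - (mean a - 1) / (mean a ^ (i + 1) - 1) := by linarith
    have ha : a = mean a / (mean a + 1) := by
      have : 1 - a ≠ 0 := by linarith
      rw [mean]
      field_simp
      ring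
    have hp : 0 < 1 - (1 - a) * extinct a i := by
      have := extinct_mem (by linarith) h1 i
      nlinarith
    rw [extinct, one_sub_div hp.ne', div_eq_div_iff hp.ne' (by linarith), hx]
    generalize mean a = m at *
    subst ha
    rw [pow_succ m (i + 1)] at *
    generalize m ^ (i + 1) = q at *
    have : q - 1 ≠ 0 := by linarith
    have : m + 1 ≠ 0 := by linarith
    field_simp
    ring

lemma summable_mean (h : 1 / 2 < a) (h1 : a < 1) :
    Summable fun n : ℕ => (mean a - 1) / (mean a ^ (n + 1) - 1) := by
  have hm := one_lt_mean h h1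
  generalize mean a = m at *
  have hg : Summable fun n : ℕ => (1 / m) ^ n :=
    summable_geometric_of_lt_one (by positivity) (by rw [div_lt_one (by linarith)]; exact hm)
  refine hg.of_nonneg_of_le (fun n => ?_) fun n => ?_
  · exact div_nonneg (by linarith) (by linarith [one_le_pow₀ hm.le (n := n + 1)])
  · have hq : 1 ≤ m ^ n := one_le_pow₀ hm.le
    have hq' : 1 < m ^ (n + 1) := one_lt_pow₀ hm (by omega)
    rw [one_div, inv_pow, ← one_div, div_le_div_iff₀ (by linarith) (by linarith), pow_succ]
    nlinarith

end Extinct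

/-- A bounded sequence with `d n = r * d (n + 1)` for some `0 ≤ r < 1` vanishes. -/
lemma eq_zero_of_eq_mul_succ {d : ℕ → ℝ} {r C : ℝ} (hr : 0 ≤ r) (hr' : r < 1)
    (hC : ∀ n, |d n| ≤ C) (h : ∀ n, d n = r * d (n + 1)) (n : ℕ) : d n = 0 := by
  have key : ∀ k, d n = r ^ k * d (n + k) := fun k => by
    induction k with
    | zero => simp
    | succ k ih => rw [ih, h (n + k), pow_succ, mul_assoc, add_assoc]
  have hb : ∀ k, |d n| ≤ r ^ k * C := fun k => by
    rw [key k, abs_mul, abs_of_nonneg (pow_nonneg hr k)]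
    exact mul_le_mul_of_nonneg_left (hC _) (pow_nonneg hr k)
  have ht := (tendsto_pow_atTop_nhds_zero_of_lt_one hr hr').mul_const C
  rw [zero_mul] at ht
  exact abs_eq_zero.1 (le_antisymm (ge_of_tendsto' ht hb) (abs_nonneg _))

/-- The increment in `j` of the probability of reaching height `j + n` from one of the vertices
`(0, 0), …, (0, j)`. -/
noncomputable def survivalIncrement (α p : I) : ℕ → ℕ → ℝ
  | 0, n => (boundarySurvival α p 0 n 0).toReal
  | j + 1, n => (boundarySurvival α p (j + 1) n 0).toReal -
      (boundarySurvival α p j (n + 1) 0).toReal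

section Solve

variable {α p : I}

lemma boundarySurvivalAux_eq (h0 : 0 < (α : ℝ)) (h1 : (α : ℝ) < 1) {j n : ℕ} {v : ℕ → ℝ}
    {s : Finset ℕ}
    (h : ∀ d, (boundarySurvival α p j (n + 1) d).toReal = ∑ i ∈ s, v i * extinct α i ^ d)
    (c d : ℕ) : (boundarySurvivalAux α p j n c d).toReal =
      ∑ i ∈ s, v i * extinct α i ^ d * extinct α (i + 1) ^ c := by
  induction c generalizing d with
  | zero => simpa [boundarySurvivalAux_zero] using h d
  | succ c ih =>
    rw [← sub_eq_zero]
    have hx := extinct_mem h0 h1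
    refine eq_zero_of_eq_mul_succ (r := 1 - α) (C := 1 + ∑ i ∈ s, |v i|)
      (d := fun d => (boundarySurvivalAux α p j n (c + 1) d).toReal -
        ∑ i ∈ s, v i * extinct α i ^ d * extinct α (i + 1) ^ (c + 1))
      (by linarith) (by linarith) (fun d => ?_) (fun d => ?_) d
    · refine (abs_sub _ _).trans (add_le_add ?_ ?_)
      · rw [abs_of_nonneg ENNReal.toReal_nonneg]
        exact ENNReal.toReal_le_of_le_ofReal zero_le_one
          (by simpa using boundarySurvivalAux_le_one α p j n (c + 1) d)
      · refine (Finset.abs_sum_le_sum_abs _ _).trans (Finset.sum_le_sum fun i _ => ?_)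
        rw [abs_mul, abs_mul, abs_pow, abs_pow, abs_of_nonneg (hx i).1,
          abs_of_nonneg (hx (i + 1)).1, mul_assoc]
        exact mul_le_of_le_one_right (abs_nonneg _) (mul_le_one₀ (pow_le_one₀ (hx i).1 (hx i).2)
          (pow_nonneg (hx _).1 _) (pow_le_one₀ (hx _).1 (hx _).2))
    · have hfin : ∀ c d, boundarySurvivalAux α p j n c d ≠ ∞ := fun c d =>
        ((boundarySurvivalAux_le_one α p j n c d).trans_lt ENNReal.one_lt_top).ne
      have hstep : (boundarySurvivalAux α p j n (c + 1) d).toReal =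
          α * (boundarySurvivalAux α p j n c d).toReal +
            (1 - α) * (boundarySurvivalAux α p j n (c + 1) (d + 1)).toReal := by
        rw [boundarySurvivalAux_succ, ENNReal.toReal_add
          (ENNReal.mul_ne_top ENNReal.coe_ne_top (hfin _ _))
          (ENNReal.mul_ne_top ENNReal.coe_ne_top (hfin _ _)), ENNReal.toReal_mul,
          ENNReal.toReal_mul]
        simp
      rw [hstep, ih, mul_sub, Finset.mul_sum, Finset.mul_sum]
      have : ∑ i ∈ s, v i * extinct α i ^ d * extinct α (i + 1) ^ (c + 1) =
          ∑ i ∈ s, (α : ℝ) * (v i * extinct α i ^ d * extinct α (i + 1) ^ c) +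
          ∑ i ∈ s, (1 - (α : ℝ)) *
            (v i * extinct α i ^ (d + 1) * extinct α (i + 1) ^ (c + 1)) := by
        rw [← Finset.sum_add_distrib]
        refine Finset.sum_congr rfl fun i _ => ?_
        have := extinct_succ_eq h0 h1 i
        calc _ = v i * extinct α i ^ d * extinct α (i + 1) ^ c * extinct α (i + 1) := by ring
          _ = v i * extinct α i ^ d * extinct α (i + 1) ^ c *
              (α + (1 - α) * extinct α i * extinct α (i + 1)) := by rw [← this]
          _ = _ := by ring
      rw [this]
      ring

lemma boundarySurvival_eq (h0 : 0 < (α : ℝ)) (h1 : (α : ℝ) < 1) (j n c : ℕ) :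
    (boundarySurvival α p j n c).toReal =
      ∑ i ∈ Finset.range (j + 1), survivalIncrement α p (j - i) (n + i) * extinct α i ^ c := by
  induction j generalizing n c with
  | zero =>
    cases c with
    | zero => simp [survivalIncrement]
    | succ c => simp [boundarySurvival_zero_succ, extinct]
  | succ j ih =>
    rw [Finset.sum_range_succ']
    have e : ∀ i, survivalIncrement α p (j + 1 - (i + 1)) (n + (i + 1)) =
        survivalIncrement α p (j - i) (n + 1 + i) := fun i => by
      rw [Nat.add_sub_add_right, add_right_comm, add_assoc]
    simp only [e]
    cases c with
    | zero =>
      have := ih (n + 1) 0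
      simp only [pow_zero, mul_one, Nat.sub_zero, add_zero] at this ⊢
      rw [← this, survivalIncrement]
      ring
    | succ c =>
      rw [boundarySurvival_succ_succ, boundarySurvivalAux_eq h0 h1 (ih (n + 1))]
      simp [extinct.eq_1]

lemma survivalIncrement_succ (h0 : 0 < (α : ℝ)) (h1 : (α : ℝ) < 1) (j n : ℕ) :
    p * survivalIncrement α p (j + 1) n = (1 - p) * (1 - α) *
      ∑ i ∈ Finset.range (j + 1),
        (1 - extinct α i) * survivalIncrement α p (j - i) (n + 1 + i) := by
  have hfin : ∀ j n c, boundarySurvival α p j n c ≠ ∞ := fun j n c =>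
    ((boundarySurvival_le_one α p j n c).trans_lt ENNReal.one_lt_top).ne
  have hstep : (boundarySurvival α p j (n + 1) 0).toReal =
      p * (boundarySurvival α p (j + 1) n 0).toReal +
        (1 - p) * (α * (boundarySurvival α p j (n + 1) 0).toReal +
          (1 - α) * (boundarySurvival α p j (n + 1) 1).toReal) := by
    conv_lhs => rw [boundarySurvival_step p h1]
    have hm : ∀ (q : NNReal) {x : ℝ≥0∞}, x ≠ ∞ → (q : ℝ≥0∞) * x ≠ ∞ := fun q x hx =>
      ENNReal.mul_ne_top ENNReal.coe_ne_top hx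
    rw [ENNReal.toReal_add (hm _ (hfin _ _ _))
      (hm _ (ENNReal.add_ne_top.2 ⟨hm _ (hfin _ _ _), hm _ (hfin _ _ _)⟩)), ENNReal.toReal_mul,
      ENNReal.toReal_mul, ENNReal.toReal_add (hm _ (hfin _ _ _)) (hm _ (hfin _ _ _)),
      ENNReal.toReal_mul, ENNReal.toReal_mul]
    simp
  have hk : ∑ i ∈ Finset.range (j + 1),
      (1 - extinct α i) * survivalIncrement α p (j - i) (n + 1 + i) =
      (boundarySurvival α p j (n + 1) 0).toReal - (boundarySurvival α p j (n + 1) 1).toReal := by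
    rw [boundarySurvival_eq h0 h1 j (n + 1) 0, boundarySurvival_eq h0 h1 j (n + 1) 1,
      ← Finset.sum_sub_distrib]
    exact Finset.sum_congr rfl fun i _ => by ring
  rw [hk, survivalIncrement]
  linarith

/-- The survival probability up to height `N` is the inverse of a partial sum of a renewal
sequence. -/
lemma survival_mul_sum_renewal (h0 : 0 < (α : ℝ)) (h1 : (α : ℝ) < 1) (hp : 0 < (p : ℝ)) (N : ℕ) :
    (survival α p N {0}).toReal * ∑ j ∈ Finset.range (N + 1),
      renewal ((1 - p) * (1 - α) / p) (fun i => 1 - extinct α i) j = 1 := by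
  set w := renewal ((1 - p) * (1 - α) / p) (fun i => 1 - extinct α i) with hw
  have key : ∀ j n, survivalIncrement α p j n = w j * (survival α p (j + n) {0}).toReal := by
    intro j
    induction j using Nat.strong_induction_on with
    | _ j ih =>
      intro n
      cases j with
      | zero => rw [survivalIncrement, boundarySurvival_zero_zero, hw, renewal_zero, one_mul,
          zero_add]
      | succ j =>
        have := survivalIncrement_succ (p := p) h0 h1 j n
        have e : ∀ i ∈ Finset.range (j + 1),
            (1 - extinct α i) * survivalIncrement α p (j - i) (n + 1 + i) =
            (1 - extinct α i) * w (j - i) * (survival α p (j + 1 + n) {0}).toReal := fun i hi => by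
          have hi' := Finset.mem_range.1 hi
          rw [ih _ (by omega), show j - i + (n + 1 + i) = j + 1 + n by omega, mul_assoc]
        rw [Finset.sum_congr rfl e, ← Finset.sum_mul] at this
        rw [hw, renewal_succ, ← hw]
        field_simp
        linarith
  have hN : (boundarySurvival α p N 0 0).toReal = 1 := by simp [boundarySurvival_zero_right]
  rw [boundarySurvival_eq h0 h1] at hN
  rw [← hN, ← Finset.sum_range_reflect, Finset.mul_sum]
  refine Finset.sum_congr rfl fun i hi => ?_
  have hi' := Finset.mem_range.1 hi
  rw [key, pow_zero, mul_one, mul_comm, show N - i + (0 + i) = N by omega]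
  congr 2

lemma survival_one_of_eq_zero (h0 : 0 < (α : ℝ)) (h1 : (α : ℝ) < 1) (hp : (p : ℝ) = 0) :
    survival α p 1 {0} = 0 := by
  have := survivalIncrement_succ (p := p) h0 h1 0 0
  have e : survivalIncrement α p 0 1 = (survival α p 1 {0}).toReal := by
    rw [survivalIncrement, boundarySurvival_zero_zero]
  simp only [hp, zero_add, Finset.range_one, Finset.sum_singleton, extinct, Nat.sub_zero, add_zero,
    e] at this
  have h2 : (survival α p 1 {0}).toReal = 0 := by
    have : (1 - (α : ℝ)) * (survival α p 1 {0}).toReal = 0 := by linarith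
    exact (mul_eq_zero.1 this).resolve_left (by linarith)
  exact (ENNReal.toReal_eq_zero_iff _).1 h2 |>.resolve_right
    ((survival_le_one α p 1 _).trans_lt ENNReal.one_lt_top).ne

end Solve

/-- The mean ratio `ρ * ∑ a` of the renewal equation is at least `1` exactly when `p` is at most the
critical point. -/
lemma le_criticalPoint_iff {a p : ℝ} (h : 1 / 2 < a) (h1 : a < 1) (hp : 0 < p) :
    p ≤ criticalPoint (mean a) ↔ 1 ≤ (1 - p) * (1 - a) / p * ∑' i, (1 - extinct a i) := by
  have hs : 0 ≤ ∑' i, (1 - extinct a i) :=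
    tsum_nonneg fun i => by linarith [extinct_mem (by linarith) h1 i]
  have he : eta (mean a) = (1 - a) * ∑' i, (1 - extinct a i) := by
    simp only [one_sub_extinct h h1]
    rw [eta]
    congr 1
    have : 1 - a ≠ 0 := by linarith
    rw [mean]
    field_simp
    ring
  have h2 : 0 ≤ (1 - a) * ∑' i, (1 - extinct a i) := mul_nonneg (by linarith) hs
  rw [criticalPoint, he, le_div_iff₀ (by linarith), div_mul_eq_mul_div, le_div_iff₀ hp]
  constructor <;> intro h <;> linarith

/-- The vertices at height `n` that can be reached from `A × {0}`. -/
def reachSet (A : Set ℕ) (θ : ℕ → ℕ → Bool) (ω : ℕ → ℕ → Prop) : ℕ → Set ℕ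
  | 0 => A
  | n + 1 => next (reachSet A θ ω n) (θ n, ω n)

lemma reachSet_seqCons (A : Set ℕ) (t : ℕ → Bool) (θ : ℕ → ℕ → Bool) (o : ℕ → Prop)
    (ω : ℕ → ℕ → Prop) (n : ℕ) :
    reachSet A (seqCons t θ) (seqCons o ω) (n + 1) = reachSet (next A (t, o)) θ ω n := by
  induction n with
  | zero => rfl
  | succ n ih => rw [reachSet, ih]; rfl

lemma measurable_reachSet (A : Set ℕ) (n : ℕ) :
    Measurable fun q : (ℕ → ℕ → Bool) × (ℕ → ℕ → Prop) => reachSet A q.1 q.2 n := by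
  induction n with
  | zero => exact measurable_const
  | succ n ih =>
    exact measurable_next.comp (ih.prodMk (((measurable_pi_apply n).comp measurable_fst).prodMk
      ((measurable_pi_apply n).comp measurable_snd)))

/-- The law of the triangles of all layers above height `0`. -/
noncomputable def trianglesLaw (α : I) : Measure (ℕ → ℕ → Bool) :=
  Measure.infinitePi fun _ : ℕ => triangleLaw α

/-- The law of the states of the edges of all layers above height `0`. -/
noncomputable def edgesLaw (p : I) : Measure (ℕ → ℕ → Prop) :=
  Measure.infinitePi fun _ : ℕ => edgeLaw p

instance (α : I) : IsProbabilityMeasure (trianglesLaw α) := by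
  unfold trianglesLaw; infer_instance

instance (p : I) : IsProbabilityMeasure (edgesLaw p) := by
  unfold edgesLaw; infer_instance

lemma lintegral_reachSet_nonempty (α p : I) (n : ℕ) (A : Set ℕ) :
    ∫⁻ θ, ∫⁻ ω, Set.indicator {B : Set ℕ | B.Nonempty} 1 (reachSet A θ ω n) ∂(edgesLaw p)
      ∂(trianglesLaw α) = survival α p n A := by
  induction n generalizing A with
  | zero => simp [reachSet, survival]
  | succ n ih =>
    have hm : Measurable fun q : (ℕ → ℕ → Bool) × (ℕ → ℕ → Prop) =>
        Set.indicator {B : Set ℕ | B.Nonempty} (1 : Set ℕ → ℝ≥0∞) (reachSet A q.1 q.2 (n + 1)) :=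
      (measurable_one.indicator measurableSet_nonempty).comp (measurable_reachSet A (n + 1))
    have e1 : ∀ θ, ∫⁻ ω, Set.indicator {B : Set ℕ | B.Nonempty} (1 : Set ℕ → ℝ≥0∞)
        (reachSet A θ ω (n + 1)) ∂(edgesLaw p) =
        ∫⁻ o, ∫⁻ ω, Set.indicator {B : Set ℕ | B.Nonempty} (1 : Set ℕ → ℝ≥0∞)
        (reachSet A θ (seqCons o ω) (n + 1)) ∂(edgesLaw p) ∂(edgeLaw p) := fun θ =>
      lintegral_infinitePi_nat _ (f := fun ω => Set.indicator {B : Set ℕ | B.Nonempty}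
        (1 : Set ℕ → ℝ≥0∞) (reachSet A θ ω (n + 1))) (hm.comp measurable_prodMk_left)
    rw [trianglesLaw, lintegral_infinitePi_nat _ hm.lintegral_prod_right', ← trianglesLaw,
      survival, layerLaw, lintegral_prod _ (measurable_survival_next α p n A).aemeasurable]
    refine lintegral_congr fun t => ?_
    simp only [e1]
    rw [lintegral_lintegral_swap]
    · refine lintegral_congr fun o => ?_
      simp only [reachSet_seqCons]
      exact ih _
    · have hc : Measurable fun q : ((ℕ → ℕ → Bool) × (ℕ → Prop)) × (ℕ → ℕ → Prop) =>
          (seqCons t q.1.1, seqCons q.1.2 q.2) :=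
        (measurable_seqCons.comp
          (measurable_const.prodMk (measurable_fst.comp measurable_fst))).prodMk
        (measurable_seqCons.comp ((measurable_snd.comp measurable_fst).prodMk measurable_snd))
      exact (hm.comp hc).lintegral_prod_right'.aemeasurable

lemma measurableSet_reachSet_nonempty (n : ℕ) :
    MeasurableSet {q : (ℕ → ℕ → Bool) × (ℕ → ℕ → Prop) | (reachSet {0} q.1 q.2 n).Nonempty} :=
  measurable_reachSet {0} n measurableSet_nonempty

lemma measure_reachSet_nonempty (α p : I) (n : ℕ) :
    ((trianglesLaw α).prod (edgesLaw p)) {q | (reachSet {0} q.1 q.2 n).Nonempty} =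
      survival α p n {0} := by
  have hs := measurableSet_reachSet_nonempty n
  rw [← lintegral_reachSet_nonempty, ← lintegral_indicator_one hs,
    lintegral_prod _ (measurable_one.indicator hs).aemeasurable]
  rfl

lemma antitone_reachSet_nonempty :
    Antitone fun n => {q : (ℕ → ℕ → Bool) × (ℕ → ℕ → Prop) |
      (reachSet {0} q.1 q.2 n).Nonempty} := by
  refine antitone_nat_of_succ_le fun n q => ?_
  rintro ⟨_, _, _, h, _⟩
  exact ⟨_, h⟩

lemma lintegral_forall_reachSet_nonempty (α p : I) :
    ∫⁻ θ, edgesLaw p {ω | ∀ n, (reachSet {0} θ ω n).Nonempty} ∂(trianglesLaw α) =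
      ⨅ n, survival α p n {0} := by
  have e : {q : (ℕ → ℕ → Bool) × (ℕ → ℕ → Prop) | ∀ n, (reachSet {0} q.1 q.2 n).Nonempty} =
      ⋂ n, {q | (reachSet {0} q.1 q.2 n).Nonempty} := by
    ext q; simp
  simp only [← measure_reachSet_nonempty]
  rw [← antitone_reachSet_nonempty.measure_iInter
    (fun n => (measurableSet_reachSet_nonempty n).nullMeasurableSet) ⟨0, measure_ne_top _ _⟩, ← e,
    Measure.prod_apply (e ▸ .iInter measurableSet_reachSet_nonempty)]
  rfl

/-- The `k`-th edge of the layer above height `j`. -/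
def layerEdge (θ : Triangulation) (j : ℤ) (k : ℕ) : Vertex × Vertex :=
  ((lowerIndex (θ j) k, j), (upperIndex (θ j) k, j + 1))

lemma lowerIndex_add_upperIndex (s : ℕ → Bool) (k : ℕ) : lowerIndex s k + upperIndex s k = k := by
  induction k with
  | zero => simp
  | succ k ih =>
    simp only [lowerIndex, upperIndex, Nat.count_succ] at ih ⊢
    cases s k <;> simp <;> omega

lemma triangle_eq (θ : Triangulation) (j : ℤ) (k : ℕ) :
    triangle θ j k = if θ j k = true then
      {(lowerIndex (θ j) k, j), (upperIndex (θ j) k, j + 1), (upperIndex (θ j) k + 1, j + 1)}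
    else
      {(lowerIndex (θ j) k, j), (lowerIndex (θ j) k + 1, j), (upperIndex (θ j) k, j + 1)} := rfl

lemma layerEdge_mem_upEdges (θ : Triangulation) (j : ℤ) (k : ℕ) :
    layerEdge θ j k ∈ upEdges θ := by
  refine ⟨rfl, j, k, ?_⟩
  rw [triangle_eq]
  split_ifs <;> simp [layerEdge]

lemma exists_layerEdge_of_mem_upEdges {θ : Triangulation} {e : Vertex × Vertex}
    (he : e ∈ upEdges θ) : ∃ j k, e = layerEdge θ j k := by
  obtain ⟨⟨a, b⟩, ⟨c, d⟩⟩ := e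
  obtain ⟨h, j, k, h1, h2⟩ := he
  have hl : lowerIndex (θ j) (k + 1) = lowerIndex (θ j) k + if θ j k = false then 1 else 0 :=
    Nat.count_succ _ _
  have hu : upperIndex (θ j) (k + 1) = upperIndex (θ j) k + if θ j k = true then 1 else 0 :=
    Nat.count_succ _ _
  simp only [height] at h
  simp only [triangle_eq] at h1 h2
  refine ⟨j, ?_⟩
  cases hb : θ j k <;>
    simp only [hb, if_true, if_false, Bool.false_eq_true, Set.mem_insert_iff,
      Set.mem_singleton_iff, Prod.mk.injEq, add_zero, reduceCtorEq] at h1 h2 hl hu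
  · rcases h1 with ⟨rfl, rfl⟩ | ⟨rfl, rfl⟩ | ⟨rfl, rfl⟩ <;>
      rcases h2 with ⟨rfl, h2⟩ | ⟨rfl, h2⟩ | ⟨rfl, h2⟩ <;> try omega
    · exact ⟨k, by rw [layerEdge, h]⟩
    · exact ⟨k + 1, by rw [layerEdge, h, hl, hu]⟩
  · rcases h1 with ⟨rfl, rfl⟩ | ⟨rfl, rfl⟩ | ⟨rfl, rfl⟩ <;>
      rcases h2 with ⟨rfl, h2⟩ | ⟨rfl, h2⟩ | ⟨rfl, h2⟩ <;> try omega
    · exact ⟨k, by rw [layerEdge, h]⟩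
    · exact ⟨k + 1, by rw [layerEdge, h, hl, hu]⟩

/-- The states of the edges of the layers above height `0`. -/
def edgeStates (θ : Triangulation) (O : Set (Vertex × Vertex)) : ℕ → ℕ → Prop :=
  fun n k => layerEdge θ n k ∈ O

lemma map_comp_infinitePi {ι κ X : Type*} [MeasurableSpace X] (μ : ι → Measure X)
    [∀ i, IsProbabilityMeasure (μ i)] {f : κ → ι} (hf : Function.Injective f) :
    (Measure.infinitePi μ).map (fun x k => x (f k)) = Measure.infinitePi fun k => μ (f k) := by
  refine Measure.eq_infinitePi _ fun s t ht => ?_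
  have hmt : ∀ i, MeasurableSet (Function.extend f t (fun _ => Set.univ) i) := fun i => by
    by_cases h : ∃ k, f k = i
    · obtain ⟨k, rfl⟩ := h
      rw [hf.extend_apply]
      exact ht k
    · rw [Function.extend_apply' _ _ _ h]
      exact .univ
  have e : (fun (x : ι → X) k => x (f k)) ⁻¹' Set.pi s t =
      Set.pi (s.map ⟨f, hf⟩ : Finset ι) (Function.extend f t fun _ => Set.univ) := by
    ext x
    simp [Set.mem_pi, hf.extend_apply]
  rw [Measure.map_apply (measurable_pi_iff.2 fun k => measurable_pi_apply (f k))
    (.pi s.countable_toSet fun k _ => ht k), e, Measure.infinitePi_pi _ fun i _ => hmt i,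
    Finset.prod_map]
  simp [hf.extend_apply]

lemma measurable_edgeStates (θ : Triangulation) : Measurable (edgeStates θ) :=
  measurable_pi_iff.2 fun _ => measurable_pi_iff.2 fun _ => measurable_set_mem _

lemma map_edgeStates_quenched (p : I) (θ : Triangulation) :
    (quenched p θ).map (edgeStates θ) = edgesLaw p := by
  have hinj : Function.Injective fun q : ℕ × ℕ => layerEdge θ q.1 q.2 := by
    rintro ⟨n, k⟩ ⟨n', k'⟩ h
    simp only [layerEdge, Prod.mk.injEq] at h
    obtain ⟨⟨h1, h2⟩, h3, -⟩ := h
    obtain rfl : n = n' := by exact_mod_cast h2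
    rw [← lowerIndex_add_upperIndex (θ n) k, ← lowerIndex_add_upperIndex (θ n) k', h1, h3]
  have e : edgeStates θ ∘ (fun q : Vertex × Vertex → Prop => {i | q i}) =
      MeasurableEquiv.curry ℕ ℕ Prop ∘ fun q k => q (layerEdge θ (k.1 : ℕ) k.2) := rfl
  have hm : Measurable fun q : Vertex × Vertex → Prop => {i | q i} :=
    measurable_set_iff.2 fun i => measurable_pi_apply i
  have hB : ∀ i, IsProbabilityMeasure
      (toNNReal p • Measure.dirac (i ∈ upEdges θ) + toNNReal (σ p) • Measure.dirac False) :=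
    fun i => by rw [← bernoulliMeasure_def]; infer_instance
  rw [quenched, setBernoulli_eq_map, Measure.map_map (measurable_edgeStates θ) hm, e,
    ← Measure.map_map (g := MeasurableEquiv.curry ℕ ℕ Prop)
      (f := fun (q : Vertex × Vertex → Prop) (k : ℕ × ℕ) => q (layerEdge θ k.1 k.2))
      (MeasurableEquiv.measurable _) (measurable_pi_iff.2 fun k => measurable_pi_apply _),
    map_comp_infinitePi (fun i => toNNReal p • Measure.dirac (i ∈ upEdges θ) +
      toNNReal (σ p) • Measure.dirac False) hinj]
  simp only [layerEdge_mem_upEdges, ← bernoulliMeasure_def]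
  exact Measure.infinitePi_map_curry fun _ _ : ℕ => bernoulliMeasure True False p

lemma mem_cluster_iff {θ : Triangulation} {O : Set (Vertex × Vertex)} (hO : O ⊆ upEdges θ)
    (v : Vertex) : v ∈ cluster O ↔
      ∃ n : ℕ, v.2 = n ∧ v.1 ∈ reachSet {0} (fun n => θ n) (edgeStates θ O) n := by
  constructor
  · intro h
    induction h with
    | refl => exact ⟨0, rfl, rfl⟩
    | tail _ h ih =>
      obtain ⟨n, h1, h2⟩ := ih
      obtain ⟨j, k, e⟩ := exists_layerEdge_of_mem_upEdges (hO h)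
      rw [e] at h
      simp only [layerEdge, Prod.mk.injEq] at e
      obtain ⟨rfl, rfl⟩ := e
      simp only at h1 h2
      subst h1
      exact ⟨n + 1, by simp, k, h, h2, rfl⟩
  · obtain ⟨x, y⟩ := v
    rintro ⟨n, rfl, h⟩
    induction n generalizing x with
    | zero =>
      obtain rfl : x = 0 := h
      exact Relation.ReflTransGen.refl
    | succ n ih =>
      obtain ⟨k, h1, h2, rfl⟩ := h
      have h3 : layerEdge θ n k ∈ O := h1
      rw [layerEdge] at h3
      push_cast
      exact Relation.ReflTransGen.tail (ih _ h2) h3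

lemma finite_next {A : Set ℕ} (hA : A.Finite) {z : Layer} (hz : {k | z.1 k = false}.Infinite) :
    (next A z).Finite := by
  obtain ⟨M, hM⟩ := hA.bddAbove
  set K := Nat.nth (fun i => z.1 i = false) (M + 1)
  have hK : lowerIndex z.1 K = M + 1 := Nat.count_nth_of_infinite hz (M + 1)
  refine ((Finset.range K).finite_toSet.image (upperIndex z.1)).subset ?_
  rintro _ ⟨k, -, h, rfl⟩
  refine ⟨k, ?_, rfl⟩
  rw [Finset.coe_range, Set.mem_Iio]
  by_contra! hk
  have h1 : lowerIndex z.1 K ≤ lowerIndex z.1 k := Nat.count_monotone _ hk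
  have h2 := hM h
  omega

lemma infinite_cluster_iff {θ : Triangulation} {O : Set (Vertex × Vertex)} (hO : O ⊆ upEdges θ)
    (hθ : ∀ n : ℕ, {k | θ n k = false}.Infinite) : (cluster O).Infinite ↔
      ∀ n, (reachSet {0} (fun n => θ n) (edgeStates θ O) n).Nonempty := by
  constructor
  · intro h n
    by_contra hn
    refine h ?_
    have hfin : ∀ m, (reachSet {0} (fun n => θ n) (edgeStates θ O) m).Finite := fun m => by
      induction m with
      | zero => exact Set.finite_singleton 0
      | succ m ih => exact finite_next ih (hθ m)
    have hU : (⋃ m ∈ Finset.range n, (fun x : ℕ => ((x, (m : ℤ)) : Vertex)) ''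
        reachSet {0} (fun n => θ n) (edgeStates θ O) m).Finite :=
      Set.Finite.biUnion (Finset.range n).finite_toSet fun m _ => (hfin m).image _
    refine hU.subset fun v hv => ?_
    obtain ⟨m, h1, h2⟩ := (mem_cluster_iff hO v).1 hv
    have hm : m < n := by
      by_contra! hm
      exact hn (antitone_reachSet_nonempty hm
        (show (fun n : ℕ => θ n, edgeStates θ O) ∈ {q : (ℕ → ℕ → Bool) × (ℕ → ℕ → Prop) |
          (reachSet {0} q.1 q.2 m).Nonempty} from ⟨_, h2⟩))
    simp only [Set.mem_iUnion]
    exact ⟨m, Finset.mem_range.2 hm, v.1, h2, Prod.ext rfl h1.symm⟩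
  · intro h
    choose x hx using h
    refine Set.infinite_of_injective_forall_mem (f := fun n : ℕ => ((x n, (n : ℤ)) : Vertex))
      (fun n n' e => by simpa using congrArg Prod.snd e) fun n => ?_
    exact (mem_cluster_iff hO _).2 ⟨n, rfl, hx n⟩

lemma ae_infinite_false {α : I} (hα : (α : ℝ) < 1) :
    ∀ᵐ s ∂(triangleLaw α), {k | s k = false}.Infinite := by
  have h0 : ∀ K : ℕ, ∀ᵐ s ∂(triangleLaw α), ∃ k, K ≤ k ∧ s k = false := fun K => by
    rw [ae_iff]
    have hle : ∀ n : ℕ, triangleLaw α {s | ¬∃ k, K ≤ k ∧ s k = false} ≤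
        (toNNReal α : ℝ≥0∞) ^ n := fun n => by
      calc _ ≤ triangleLaw α (Set.pi (Finset.Ico K (K + n) : Finset ℕ) fun _ => {true}) := by
            refine measure_mono fun s hs k hk => ?_
            simp only [Finset.coe_Ico, Set.mem_Ico] at hk
            by_contra h
            exact hs ⟨k, hk.1, by simpa using h⟩
        _ = (toNNReal α : ℝ≥0∞) ^ n := by
            rw [triangleLaw, Measure.infinitePi_pi _ fun _ _ => measurableSet_singleton _]
            simp [bernoulliMeasure_def]
    have hlt : (toNNReal α : ℝ≥0∞) < 1 := by
      rw [← ENNReal.coe_one, ENNReal.coe_lt_coe, ← NNReal.coe_lt_coe]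
      simpa using hα
    exact le_antisymm (ge_of_tendsto' (ENNReal.tendsto_pow_atTop_nhds_zero_of_lt_one hlt) hle)
      zero_le
  filter_upwards [ae_all_iff.2 h0] with s hs
  refine Set.infinite_of_not_bddAbove ?_
  rintro ⟨M, hM⟩
  obtain ⟨k, h1, h2⟩ := hs (M + 1)
  have := hM h2
  omega

lemma percolationProb_eq_iInf {α : I} (hα : (α : ℝ) < 1) (p : I) :
    percolationProb α p = ⨅ n, survival α p n {0} := by
  have hmeas : MeasurableSet {q : (ℕ → ℕ → Bool) × (ℕ → ℕ → Prop) |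
      ∀ n, (reachSet {0} q.1 q.2 n).Nonempty} := by
    rw [Set.ofPred_forall]
    exact .iInter measurableSet_reachSet_nonempty
  have hgood : ∀ᵐ θ ∂(law α), ∀ n : ℕ, {k | θ n k = false}.Infinite :=
    ae_all_iff.2 fun n => (measurePreserving_eval_infinitePi
      (fun _ : ℤ => triangleLaw α) n).quasiMeasurePreserving.ae (ae_infinite_false hα)
  have h1 : ∀ᵐ θ ∂(law α), quenched p θ {O | (cluster O).Infinite} =
      edgesLaw p {ω | ∀ n, (reachSet {0} (fun n => θ n) ω n).Nonempty} := by
    filter_upwards [hgood] with θ hθ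
    have hm : MeasurableSet {ω | ∀ n, (reachSet {0} (fun n => θ n) ω n).Nonempty} :=
      measurable_prodMk_left (x := fun n : ℕ => θ n) hmeas
    rw [← map_edgeStates_quenched p θ, Measure.map_apply (measurable_edgeStates θ) hm]
    refine measure_congr ?_
    have hsub : ∀ᵐ O ∂(quenched p θ), O ⊆ upEdges θ := setBernoulli_ae_subset
    filter_upwards [hsub] with O hO
    exact propext (infinite_cluster_iff hO hθ)
  have hmap : (law α).map (fun θ (n : ℕ) => θ n) = trianglesLaw α :=
    map_comp_infinitePi (fun _ : ℤ => triangleLaw α) Nat.cast_injective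
  rw [percolationProb, lintegral_congr_ae h1, ← lintegral_forall_reachSet_nonempty, ← hmap,
    lintegral_map (f := fun θ => edgesLaw p {ω | ∀ n, (reachSet {0} θ ω n).Nonempty})
      (measurable_measure_prodMk_left hmeas)
      (measurable_pi_iff.2 fun n => measurable_pi_apply _)]

end SCTHP

theorem mainTheorem4 (α : unitInterval) (hα : 1 / 2 < (α : ℝ)) (hα' : (α : ℝ) < 1) :
    (Summable fun n : ℕ =>
      (SCTHP.mean α - 1) / ((SCTHP.mean α) ^ (n + 1) - 1)) ∧
    ∀ p : unitInterval,
      ((p : ℝ) ≤ SCTHP.criticalPoint (SCTHP.mean α) → SCTHP.percolationProb α p = 0) ∧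
      (SCTHP.criticalPoint (SCTHP.mean α) < (p : ℝ) → 0 < SCTHP.percolationProb α p) := by
  have h0 : 0 < (α : ℝ) := by linarith
  have hsum := SCTHP.summable_mean hα hα'
  refine ⟨hsum, fun p => ?_⟩
  have ha : ∀ i, 0 ≤ 1 - SCTHP.extinct α i := fun i => by
    linarith [(SCTHP.extinct_mem h0 hα' i).2]
  have hs : Summable fun i => 1 - SCTHP.extinct α i := by
    simpa only [SCTHP.one_sub_extinct hα hα'] using hsum
  have hfin : ∀ n, SCTHP.survival α p n {0} ≠ ⊤ := fun n =>
    ((SCTHP.survival_le_one α p n _).trans_lt ENNReal.one_lt_top).ne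
  rw [SCTHP.percolationProb_eq_iInf hα']
  rcases p.2.1.eq_or_lt with hp | hp
  · refine ⟨fun _ => ?_, fun h => ?_⟩
    · exact le_antisymm
        ((iInf_le _ 1).trans_eq (SCTHP.survival_one_of_eq_zero h0 hα' hp.symm)) zero_le
    · have hm := SCTHP.one_lt_mean hα hα'
      have he : 0 ≤ SCTHP.eta (SCTHP.mean α) := mul_nonneg (by positivity) <|
        tsum_nonneg fun n => by rw [← SCTHP.one_sub_extinct hα hα']; exact ha n
      have : 0 ≤ SCTHP.criticalPoint (SCTHP.mean α) := div_nonneg he (by linarith)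
      linarith
  have hρ : 0 ≤ (1 - (p : ℝ)) * (1 - α) / p :=
    div_nonneg (mul_nonneg (by linarith [p.2.2]) (by linarith)) hp.le
  have hS := SCTHP.survival_mul_sum_renewal h0 hα' hp
  have hpos : ∀ n, 0 < ∑ j ∈ Finset.range (n + 1), SCTHP.renewal ((1 - p) * (1 - α) / p)
      (fun i => 1 - SCTHP.extinct α i) j := fun n => by
    refine lt_of_le_of_ne (Finset.sum_nonneg fun j _ => SCTHP.renewal_nonneg hρ ha j) fun h => ?_
    have := hS n
    rw [← h, mul_zero] at this
    exact zero_ne_one this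
  rw [SCTHP.le_criticalPoint_iff hα hα' hp, ← not_le, SCTHP.le_criticalPoint_iff hα hα' hp, not_le]
  constructor
  · intro h
    by_contra hne
    have hL : 0 < (⨅ n, SCTHP.survival α p n {0}).toReal :=
      ENNReal.toReal_pos hne ((iInf_le (fun n => SCTHP.survival α p n {0}) 0).trans_lt (hfin 0).lt_top).ne
    obtain ⟨N, hN⟩ := SCTHP.exists_lt_sum_renewal hρ ha hs h
      (1 / (⨅ n, SCTHP.survival α p n {0}).toReal)
    have h1 : (⨅ n, SCTHP.survival α p n {0}).toReal ≤ (SCTHP.survival α p N {0}).toReal :=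
      ENNReal.toReal_mono (hfin N) (iInf_le _ N)
    have h2 := hS N
    rw [Finset.sum_range_succ] at h2
    rw [div_lt_iff₀ hL] at hN
    have h3 := mul_nonneg (ENNReal.toReal_nonneg (a := SCTHP.survival α p N {0}))
      (SCTHP.renewal_nonneg hρ ha N)
    have h4 := mul_le_mul_of_nonneg_left h1
      (Finset.sum_nonneg fun j (_ : j ∈ Finset.range N) => SCTHP.renewal_nonneg hρ ha j)
    linarith
  · intro h
    have hb : 0 < 1 - (1 - (p : ℝ)) * (1 - α) / p * ∑' i, (1 - SCTHP.extinct α i) := by linarith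
    refine (ENNReal.ofReal_pos.2 hb).trans_le (le_iInf fun n => ?_)
    rw [ENNReal.ofReal_le_iff_le_toReal (hfin n)]
    have h1 := SCTHP.sum_renewal_le hρ ha hs h (n + 1)
    rw [le_div_iff₀ hb] at h1
    have h2 := hS n
    rw [← eq_div_iff (hpos n).ne'] at h2
    rw [h2, le_div_iff₀ (hpos n)]
    linarith
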